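/- For $n\ge 1$ let $\Omega_n$ be the spectral ball, i.e. the set of complex $n\times n$ matrices all of whose eigenvalues have modulus less than $1$, and let $\mathbb D$ be the open unit disc in $\mathbb C$. For $A,B\in\Omega_n$ let $$l_{\Omega_n}(A,B)=\inf\{|\alpha| : \alpha\in\mathbb D \text{ and there is a holomorphic } \varphi:\mathbb D\to\Omega_n \text{ with } \varphi(0)=A,\ \varphi(\alpha)=B\}$$ be the Lempert function of $\Omega_n$. A matrix $A$ is called cyclic if there is a vector $v\in\mathbb C^n$ such that the vectors $A^kv$, $k\ge 0$, span $\mathbb C^n$; otherwise it is called derogatory. Theorem. Let $A\in\Omega_n$. (1) If $A$ is derogatory, then there exists $B\in\Omega_n$ such that the function $l_{\Omega_n}(\cdot,B):\Omega_n\to[0,1)$ is not continuous at $A$. (2) More strongly, if there is a neighbourhood $U$ of $A$ in $\Omega_n$ such that $l_{\Omega_n}(\cdot,B)$ is continuous at $A$ for every $B\in U$, then $A$ is cyclic. -/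

import Mathlib

open scoped Topology Matrix

/-- The spectral ball `Ω_n`: complex `n × n` matrices of spectral radius less than `1`. -/
def spectralBall (n : ℕ) : Set (Matrix (Fin n) (Fin n) ℂ) :=
  {A | spectralRadius ℂ A < 1}

/-- A matrix is cyclic (non-derogatory) if it admits a cyclic vector, that is, a vector `v` for
which `v, A v, A² v, …` span the whole space. -/
def IsCyclicMatrix {n : ℕ} (A : Matrix (Fin n) (Fin n) ℂ) : Prop :=
  ∃ v : Fin n → ℂ, Submodule.span ℂ (Set.range fun k : ℕ => (A ^ k) *ᵥ v) = ⊤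

/-- The Lempert function of a set `D` of complex `n × n` matrices: the infimum of `|α|` over all
`α` in the open unit disc for which some map `φ`, holomorphic on the disc and with values in `D`
there (holomorphic means that every matrix entry is holomorphic), has `φ 0 = Z` and `φ α = W`. -/
noncomputable def lempertFunction {n : ℕ} (D : Set (Matrix (Fin n) (Fin n) ℂ))
    (Z W : Matrix (Fin n) (Fin n) ℂ) : ℝ :=
  sInf {r : ℝ | ∃ α ∈ Metric.ball (0 : ℂ) 1, ∃ φ : ℂ → Matrix (Fin n) (Fin n) ℂ,
    (∀ i j, DifferentiableOn ℂ (fun ζ => φ ζ i j) (Metric.ball (0 : ℂ) 1)) ∧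
    Set.MapsTo φ (Metric.ball (0 : ℂ) 1) D ∧ φ 0 = Z ∧ φ α = W ∧ r = ‖α‖}

/-!
Let `A` be derogatory. Then some eigenvalue `μ` of `A` has geometric multiplicity at least two
(`exists_rank_add_two_le`), so for every holomorphic disc `φ` in the spectral ball with `φ 0 = A`
the bounded function `det (φ - μ)` vanishes to second order at `0`. By the Schwarz lemma
`‖det (B - μ)‖ ≤ 2 ^ n * ‖α‖ ^ 2` whenever `φ α = B`, that is, `l(A, B)` is at least of the order of
`‖det (B - μ)‖ ^ (1 / 2)` (`norm_det_sub_scalar_le_of_disc`).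

Near `A` there is no such obstruction. Let `C` be the bidiagonal cyclic matrix with the eigenvalues
of `A`. Then `A` is a limit of conjugates of `C` (`mem_closure_conj_lowerBidiagonal`), and for
a small multiple `E` of the corner matrix unit the disc `ζ ↦ C + ζ E` lies in the spectral ball,
while `det (C + ζ E - μ)` is a nonzero multiple of `ζ` (`norm_det_lowerBidiagonal_add_single`).
Any two invertible matrices are values at `0` and `ε` of an entire curve of invertible matrices
(`exists_entire_path`). Conjugating the disc by such a curve shows
`l(P C P⁻¹, Q (C + ε E) Q⁻¹) ≤ ε` for all invertible `P` and `Q` (`lempertFunction_conj_le`).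

Fix `Q` with `Q C Q⁻¹` close to `A` and put `B = Q (C + ε E) Q⁻¹` with `ε` small. Then `l(A, B)` is at
least a constant times `ε ^ (1 / 2)`, hence at least `2 ε`, while `l(·, B) ≤ ε` at the conjugates of
`C` that accumulate at `A`. So `l(·, B)` is not continuous at `A`, and `B` is as close to `A` as
desired.
-/

/-! ### The spectral ball -/

open scoped Matrix.Norms.Operator in
/-- By Gelfand's formula some power of a matrix in the spectral ball has norm `< 1`, and this
persists nearby and bounds the spectral radius by `1`. -/
theorem isOpen_spectralBall (n : ℕ) : IsOpen (spectralBall n) := by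
  rw [isOpen_iff_mem_nhds]
  intro A hA
  rcases Nat.eq_zero_or_pos n with rfl | hn
  · have : spectralBall 0 = Set.univ := by
      ext B
      simp [spectralBall]
    simp [this]
  have : Nonempty (Fin n) := ⟨⟨0, hn⟩⟩
  have hlim := spectrum.pow_nnnorm_pow_one_div_tendsto_nhds_spectralRadius A
  have hev := (hlim.comp (Filter.tendsto_add_atTop_nat 1)).eventually_lt_const
    (show spectralRadius ℂ A < 1 from hA)
  obtain ⟨k, hk⟩ := hev.exists
  have hcont : Continuous fun B : Matrix (Fin n) (Fin n) ℂ =>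
      ((‖B ^ (k + 1)‖₊ : ENNReal)) ^ (1 / ((k + 1 : ℕ) : ℝ)) := by
    refine (ENNReal.continuous_rpow_const).comp (ENNReal.continuous_coe.comp ?_)
    exact (continuous_pow (k + 1)).nnnorm
  have hnear := (hcont.tendsto A).eventually_lt_const (u := 1) hk
  filter_upwards [hnear] with B hB
  refine lt_of_le_of_lt ?_ hB
  simpa using spectrum.spectralRadius_le_pow_nnnorm_pow_one_div ℂ B k

theorem conj_mem_spectralBall {n : ℕ} {P Q M : Matrix (Fin n) (Fin n) ℂ} (h : P * Q = 1)
    (hM : M ∈ spectralBall n) : P * M * Q ∈ spectralBall n := by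
  have h' : Q * P = 1 := mul_eq_one_comm.mp h
  have := spectrum.units_conjugate (R := ℂ) (a := M) (u := ⟨P, Q, h, h'⟩)
  have h2 : spectrum ℂ (P * M * Q) = spectrum ℂ M := this
  simpa only [spectralBall, spectralRadius, Set.mem_ofPred_eq, h2] using hM

theorem norm_lt_one_of_mem_spectrum {n : ℕ} {M : Matrix (Fin n) (Fin n) ℂ}
    (hM : M ∈ spectralBall n) {μ : ℂ} (hμ : μ ∈ spectrum ℂ M) : ‖μ‖ < 1 := by
  have h : (‖μ‖₊ : ENNReal) ≤ spectralRadius ℂ M := le_iSup₂ (α := ENNReal) μ hμ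
  have := h.trans_lt hM
  exact_mod_cast this

theorem norm_det_sub_scalar_le {n : ℕ} {M : Matrix (Fin n) (Fin n) ℂ}
    (hM : M ∈ spectralBall n) {μ : ℂ} (hμ : ‖μ‖ ≤ 1) :
    ‖(M - Matrix.scalar (Fin n) μ).det‖ ≤ 2 ^ n := by
  have h1 : ‖(M - Matrix.scalar (Fin n) μ).det‖ = ‖M.charpoly.eval μ‖ := by
    rw [Matrix.eval_charpoly, ← neg_sub, Matrix.det_neg]
    simp
  have hs : M.charpoly.Splits := IsAlgClosed.splits _
  have hcard : M.charpoly.roots.card = n := by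
    rw [← hs.natDegree_eq_card_roots, Matrix.charpoly_natDegree_eq_dim]; simp
  rw [h1, hs.eval_eq_prod_roots_of_monic (Matrix.charpoly_monic M)]
  have key : ∀ s : Multiset ℂ, (∀ x ∈ s, ‖x‖ ≤ 1) →
      ‖(s.map fun x => μ - x).prod‖ ≤ 2 ^ s.card := by
    intro s
    induction s using Multiset.induction_on with
    | empty => simp
    | cons a s ih =>
      intro h
      have ha := h a (by simp)
      have hs := ih fun x hx => h x (by simp [hx])
      rw [Multiset.map_cons, Multiset.prod_cons, norm_mul, Multiset.card_cons, pow_succ']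
      gcongr
      exact (norm_sub_le _ _).trans (by linarith)
  simpa only [hcard] using key _ fun x hx => (norm_lt_one_of_mem_spectrum hM
    (Matrix.mem_spectrum_iff_isRoot_charpoly.2 (Polynomial.isRoot_of_mem_roots hx))).le

/-! ### Derogatory matrices and the lower estimate -/

/-- If a holomorphic matrix function drops rank by two at `0`, its determinant vanishes there to
second order: after multiplication by constant invertible matrices, two rows vanish at `0`. -/
theorem isLittleO_det_of_rank {n : ℕ} {M : ℂ → Matrix (Fin n) (Fin n) ℂ}
    (hM : ∀ i j, DifferentiableAt ℂ (fun z => M z i j) 0) (hrank : (M 0).rank + 2 ≤ n) :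
    (fun z => (M z).det) =o[𝓝 0] fun z => ‖z‖ := by
  obtain ⟨L, L', D, hD⟩ :=
    Matrix.Pivot.exists_list_transvec_mul_mul_list_transvec_eq_diagonal (M 0)
  set P := (L.map Matrix.TransvectionStruct.toMatrix).prod
  set Q := (L'.map Matrix.TransvectionStruct.toMatrix).prod
  have hP : P.det = 1 := Matrix.TransvectionStruct.det_toMatrix_prod L
  have hQ : Q.det = 1 := Matrix.TransvectionStruct.det_toMatrix_prod L'
  have hrD : (Matrix.diagonal D).rank + 2 ≤ n := by
    rw [← hD, Matrix.rank_mul_eq_left_of_isUnit_det _ _ (by simp [hQ]),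
      Matrix.rank_mul_eq_right_of_isUnit_det _ _ (by simp [hP])]
    exact hrank
  obtain ⟨p, q, hpq, hp, hq⟩ : ∃ p q, p ≠ q ∧ D p = 0 ∧ D q = 0 := by
    rw [Matrix.rank_diagonal] at hrD
    have h1 := Fintype.card_subtype_compl (fun i => D i = 0)
    have h2 := Fintype.card_subtype_le (fun i => D i = 0)
    rw [Fintype.card_fin] at h1 h2
    have h3 : 1 < Fintype.card {i // D i = 0} := by
      have : Fintype.card {i // ¬ D i = 0} + 2 ≤ n := hrD
      omega
    obtain ⟨a, b, hab⟩ := Fintype.one_lt_card_iff.1 h3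
    exact ⟨a, b, fun h => hab (Subtype.ext h), a.2, b.2⟩
  have hdet : ∀ z, (M z).det = (P * M z * Q).det := by simp [hP, hQ]
  have hN : ∀ i j, DifferentiableAt ℂ (fun z => (P * M z * Q) i j) 0 := by
    intro i j
    simp only [Matrix.mul_apply]
    fun_prop
  simp only [hdet, Matrix.det_apply']
  have hone : ∀ i j, (fun z => (P * M z * Q) i j) =O[𝓝 0] fun _ => (1 : ℝ) := fun i j =>
    (hN i j).continuousAt.isBigO_one ℝ
  have hlin : ∀ i j, D i = 0 → (fun z => (P * M z * Q) i j) =O[𝓝 0] fun z : ℂ => ‖z‖ := by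
    intro i j hi
    have h0 : (P * M 0 * Q) i j = 0 := by
      rw [hD, Matrix.diagonal_apply]
      split_ifs <;> simp [hi]
    have := (hN i j).isBigO_sub
    simpa [h0] using this.norm_right
  refine Asymptotics.IsLittleO.fun_sum fun σ _ => Asymptotics.IsLittleO.const_mul_left ?_ _
  have hne : σ.symm q ≠ σ.symm p := fun h => hpq (σ.symm.injective h).symm
  have hsplit : ∀ z, ∏ i, (P * M z * Q) (σ i) i =
      (P * M z * Q) p (σ.symm p) * ((P * M z * Q) q (σ.symm q) *
        ∏ i ∈ (Finset.univ.erase (σ.symm p)).erase (σ.symm q), (P * M z * Q) (σ i) i) := by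
    intro z
    rw [← Finset.mul_prod_erase Finset.univ _ (Finset.mem_univ (σ.symm p)),
      ← Finset.mul_prod_erase (Finset.univ.erase (σ.symm p)) _
        (Finset.mem_erase.2 ⟨hne, Finset.mem_univ _⟩)]
    simp
  simp only [hsplit]
  have hrest : (fun z => ∏ i ∈ (Finset.univ.erase (σ.symm p)).erase (σ.symm q),
      (P * M z * Q) (σ i) i) =O[𝓝 0] fun _ => (1 : ℝ) := by
    simpa using Asymptotics.IsBigO.finsetProd (s := (Finset.univ.erase (σ.symm p)).erase (σ.symm q))
      (f := fun i z => (P * M z * Q) (σ i) i) (g := fun _ _ => (1 : ℝ)) fun i _ => hone (σ i) i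
  refine ((hlin p (σ.symm p) hp).mul ((hlin q (σ.symm q) hq).mul hrest)).trans_isLittleO ?_
  have hz : (fun z : ℂ => ‖z‖) =o[𝓝 0] fun _ => (1 : ℝ) := by
    rw [Asymptotics.isLittleO_one_iff]
    simpa using (continuous_norm (E := ℂ)).tendsto 0
  simpa using (Asymptotics.isBigO_refl (fun z : ℂ => ‖z‖) (𝓝 0)).mul_isLittleO hz

/-- The lower estimate for discs through `A`: where the rank of `A - μ` is at most `n - 2`, the
function `det (φ - μ)` is bounded on the disc and vanishes to second order at `0`, so the Schwarz
lemma bounds it by a multiple of `‖ζ‖ ^ 2`. -/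
theorem norm_det_sub_scalar_le_of_disc {n : ℕ} {A B : Matrix (Fin n) (Fin n) ℂ} {μ : ℂ}
    (hμ : ‖μ‖ ≤ 1) (hrank : (A - Matrix.scalar (Fin n) μ).rank + 2 ≤ n)
    {α : ℂ} (hα : α ∈ Metric.ball (0 : ℂ) 1) {φ : ℂ → Matrix (Fin n) (Fin n) ℂ}
    (hφ : ∀ i j, DifferentiableOn ℂ (fun ζ => φ ζ i j) (Metric.ball (0 : ℂ) 1))
    (hmaps : Set.MapsTo φ (Metric.ball (0 : ℂ) 1) (spectralBall n))
    (h0 : φ 0 = A) (hB : φ α = B) :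
    ‖(B - Matrix.scalar (Fin n) μ).det‖ ≤ 2 ^ n * ‖α‖ ^ 2 := by
  subst h0 hB
  set M : ℂ → Matrix (Fin n) (Fin n) ℂ := fun z => φ z - Matrix.scalar (Fin n) μ with hM
  have hMd : ∀ i j, DifferentiableOn ℂ (fun z => M z i j) (Metric.ball (0 : ℂ) 1) := fun i j =>
    (hφ i j).sub_const _
  have hdet : DifferentiableOn ℂ (fun z => (M z).det) (Metric.ball (0 : ℂ) 1) := by
    simp only [Matrix.det_apply']
    fun_prop
  have hlo := isLittleO_det_of_rank (M := M)
    (fun i j => (hMd i j).differentiableAt (Metric.ball_mem_nhds 0 one_pos)) hrank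
  have hzero : (M 0).det = 0 := by
    by_contra hne
    have := Matrix.rank_of_isUnit (M 0) ((Matrix.isUnit_iff_isUnit_det _).2 (Ne.isUnit hne))
    rw [Fintype.card_fin] at this
    have h2 : (M 0).rank + 2 ≤ n := hrank
    omega
  have := Complex.dist_le_mul_div_pow_of_mapsTo_ball_of_isLittleO (n := 1) (R₂ := 2 ^ n) hdet
    (fun z hz => by
      simpa [hzero, -Matrix.scalar_apply] using norm_det_sub_scalar_le (hmaps hz) hμ)
    (by simpa [hzero] using hlo) hα
  simpa [hzero, -Matrix.scalar_apply] using this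

/-- A derogatory matrix has an eigenvalue of geometric multiplicity at least two. Otherwise the
transposed endomorphism has finitely many eigenlines, and a vector annihilated by none of them is
cyclic: the annihilator of a proper invariant subspace would contain an eigenvector. -/
theorem exists_rank_add_two_le {n : ℕ} {A : Matrix (Fin n) (Fin n) ℂ} (hA : ¬ IsCyclicMatrix A) :
    ∃ μ ∈ spectrum ℂ A, (A - Matrix.scalar (Fin n) μ).rank + 2 ≤ n := by
  set f : Module.End ℂ (Fin n → ℂ) := Matrix.toLin' A with hf
  set g : Module.End ℂ (Module.Dual ℂ (Fin n → ℂ)) := f.dualMap with hg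
  have hsub : ∀ μ : ℂ, Module.finrank ℂ (g.eigenspace μ) +
      (A - Matrix.scalar (Fin n) μ).rank = n := by
    intro μ
    have h1 : (A - Matrix.scalar (Fin n) μ).mulVecLin = f - algebraMap ℂ _ μ := by
      rw [← Matrix.toLin'_apply', map_sub, hf]
      congr 1
      ext x y
      simp [Pi.single_apply]
    have h2 : g - algebraMap ℂ _ μ = (f - algebraMap ℂ _ μ).dualMap := by
      ext x y
      simp [hg]
    have h3 := LinearMap.finrank_range_dualMap_eq_finrank_range (f - algebraMap ℂ _ μ)
    have h4 := LinearMap.finrank_range_add_finrank_ker (f - algebraMap ℂ _ μ).dualMap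
    rw [Subspace.dual_finrank_eq, Module.finrank_fin_fun] at h4
    rw [Module.End.eigenspace_def, ← Algebra.algebraMap_eq_smul_one, h2, Matrix.rank, h1, add_comm]
    exact (congrArg (· + _) h3.symm).trans h4
  by_contra! hrk
  have hdim : ∀ μ : ℂ, Module.finrank ℂ (g.eigenspace μ) ≤ 1 := by
    intro μ
    have h1 := hsub μ
    by_cases hμ : μ ∈ spectrum ℂ A
    · have := hrk μ hμ
      omega
    · rw [spectrum.notMem_iff] at hμ
      have hu : IsUnit (A - Matrix.scalar (Fin n) μ) := by
        rw [← neg_sub]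
        exact hμ.neg
      rw [Matrix.rank_of_isUnit _ hu, Fintype.card_fin] at h1
      omega
  have : Finite {μ | g.HasEigenvalue μ} := Module.End.finite_hasEigenvalue g
  choose ℓ hℓ using fun μ : {μ | g.HasEigenvalue μ} => μ.2.exists_hasEigenvector
  -- A vector avoiding the finitely many hyperplanes given by the eigenfunctionals.
  obtain ⟨v, hv⟩ := Module.Dual.exists_forall_ne_zero_of_forall_exists ℓ fun μ => by
    by_contra! h
    exact (hℓ μ).2 (LinearMap.ext h)
  refine hA ⟨v, ?_⟩
  set W := Submodule.span ℂ (Set.range fun k : ℕ => (A ^ k) *ᵥ v) with hW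
  by_contra hne
  have hWinv : W ≤ W.comap f := by
    rw [hW, Submodule.span_le]
    rintro _ ⟨k, rfl⟩
    refine Submodule.subset_span ⟨k + 1, ?_⟩
    simp [hf, pow_succ', Matrix.mulVec_mulVec]
  have hginv : ∀ w ∈ W.dualAnnihilator, g w ∈ W.dualAnnihilator := by
    intro w hw
    rw [Submodule.mem_dualAnnihilator] at hw ⊢
    exact fun x hx => hw _ (hWinv hx)
  have hnt : Nontrivial W.dualAnnihilator := by
    rw [Submodule.nontrivial_iff_ne_bot]
    intro h
    exact hne ((Subspace.dualAnnihilator_inj (V := Fin n → ℂ)).1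
      (by rw [h, Submodule.dualAnnihilator_top]))
  obtain ⟨μ, hμ⟩ := Module.End.exists_eigenvalue (g.restrict hginv)
  obtain ⟨w, hw⟩ := hμ.exists_hasEigenvector
  have hw1 : (w : Module.Dual ℂ (Fin n → ℂ)) ∈ g.eigenspace μ := by
    rw [Module.End.mem_eigenspace_iff]
    simpa using congrArg Subtype.val hw.apply_eq_smul
  have hw0 : (w : Module.Dual ℂ (Fin n → ℂ)) ≠ 0 := by
    simpa using hw.2
  have hμg : g.HasEigenvalue μ := Module.End.hasEigenvalue_of_hasEigenvector ⟨hw1, hw0⟩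
  have hwv : (w : Module.Dual ℂ (Fin n → ℂ)) v = 0 :=
    (Submodule.mem_dualAnnihilator _).1 w.2 v (Submodule.subset_span ⟨0, by simp⟩)
  obtain ⟨c, hc⟩ := finrank_le_one_iff.1 (hdim μ)
  obtain ⟨a, ha⟩ := hc ⟨w, hw1⟩
  obtain ⟨b, hb⟩ := hc ⟨ℓ ⟨μ, hμg⟩, (hℓ ⟨μ, hμg⟩).1⟩
  have ha' : a • (c : Module.Dual ℂ (Fin n → ℂ)) = w := congrArg Subtype.val ha
  have hb' : b • (c : Module.Dual ℂ (Fin n → ℂ)) = ℓ ⟨μ, hμg⟩ := congrArg Subtype.val hb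
  have ha0 : a ≠ 0 := fun h => hw0 (by rw [← ha', h, zero_smul])
  have hcv : (c : Module.Dual ℂ (Fin n → ℂ)) v = 0 := by
    rw [← ha'] at hwv
    simpa [ha0] using hwv
  apply hv ⟨μ, hμg⟩
  rw [← hb']
  simp [hcv]

/-! ### Triangularization -/

/-- Triangularization over `ℂ`: an eigenvector of the dual map has an invariant hyperplane as kernel,
and a triangularizing basis of that hyperplane extends. -/
theorem exists_basis_lowerTriangular {V : Type*} [AddCommGroup V] [Module ℂ V]
    [FiniteDimensional ℂ V] {n : ℕ} (hn : Module.finrank ℂ V = n) (f : Module.End ℂ V) :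
    ∃ b : Module.Basis (Fin n) ℂ V, ∀ i j, i < j → b.repr (f (b j)) i = 0 := by
  induction n generalizing V with
  | zero => exact ⟨Module.finBasisOfFinrankEq ℂ V hn, fun i => i.elim0⟩
  | succ n ih =>
    have : Nontrivial V := Module.nontrivial_of_finrank_pos (R := ℂ) (by omega)
    obtain ⟨μ, hμ⟩ := Module.End.exists_eigenvalue (f.dualMap : Module.End ℂ (Module.Dual ℂ V))
    obtain ⟨ℓ, hℓ⟩ := hμ.exists_hasEigenvector
    have hℓf : ∀ x, ℓ (f x) = μ * ℓ x := fun x => by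
      simpa using LinearMap.congr_fun hℓ.apply_eq_smul x
    obtain ⟨y, hy⟩ : ∃ y, ℓ y ≠ 0 := by
      by_contra! h
      exact hℓ.2 (LinearMap.ext h)
    set W := LinearMap.ker ℓ with hW
    have hWf : ∀ x ∈ W, f x ∈ W := fun x hx => by
      rw [hW, LinearMap.mem_ker] at hx ⊢
      rw [hℓf, hx, mul_zero]
    have hWn : Module.finrank ℂ W = n := by
      have : Module.finrank ℂ W + 1 = _ := Module.Dual.finrank_ker_add_one_of_ne_zero hℓ.2
      omega
    obtain ⟨b, hb⟩ := ih hWn (f.restrict hWf)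
    let B : Module.Basis (Fin (n + 1)) ℂ V := Module.Basis.mkFinCons y b
      (fun c x hx h => by
        have := congrArg ℓ h
        rw [map_add, LinearMap.mem_ker.1 hx, map_smul, add_zero, map_zero] at this
        simpa [hy] using this)
      (fun z => ⟨-(ℓ z / ℓ y), by
        rw [hW, LinearMap.mem_ker]
        simp [hy]⟩)
    have hB0 : B 0 = y := by simp [B]
    have hBs : ∀ i : Fin n, B i.succ = b i := fun i => by simp [B]
    have hrepr : ∀ x : W, ∀ i, B.repr (x : V) i =
        (Fin.cons 0 (fun i => b.repr x i) : Fin (n + 1) → ℂ) i := by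
      intro x i
      have : (x : V) = ∑ i, (Fin.cons 0 (fun i => b.repr x i) : Fin (n + 1) → ℂ) i • B i := by
        rw [Fin.sum_univ_succ]
        simp only [Fin.cons_zero, zero_smul, zero_add, Fin.cons_succ, hBs]
        conv_lhs => rw [← b.sum_repr x]
        simp only [Submodule.coe_sum, Submodule.coe_smul]
      conv_lhs => rw [this]
      rw [B.repr_sum_self]
    refine ⟨B, fun i j hij => ?_⟩
    obtain ⟨j, rfl⟩ := Fin.exists_succ_eq.2 (Fin.ne_zero_of_lt hij)
    rw [hBs]
    have := hrepr (f.restrict hWf (b j)) i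
    rw [LinearMap.coe_restrict_apply] at this
    rw [this]
    induction i using Fin.cases with
    | zero => simp
    | succ i => simpa using hb i j (by simpa using hij)

theorem exists_lowerTriangular_conj {n : ℕ} (A : Matrix (Fin n) (Fin n) ℂ) :
    ∃ P Q T : Matrix (Fin n) (Fin n) ℂ, P * Q = 1 ∧ A = P * T * Q ∧ ∀ i j, i < j → T i j = 0 := by
  obtain ⟨b, hb⟩ := exists_basis_lowerTriangular (Module.finrank_fin_fun ℂ) (Matrix.toLin' A)
  set e := Pi.basisFun ℂ (Fin n)
  refine ⟨e.toMatrix b, b.toMatrix e, LinearMap.toMatrix b b (Matrix.toLin' A),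
    e.toMatrix_mul_toMatrix_flip b, ?_, fun i j hij => ?_⟩
  · rw [basis_toMatrix_mul_linearMap_toMatrix_mul_basis_toMatrix]
    exact (LinearMap.toMatrix'_toLin' A).symm
  · rw [LinearMap.toMatrix_apply]
    exact hb i j hij

/-! ### Entire curves of invertible matrices -/

/-- `1` and any invertible matrix lie on an entire curve of invertible matrices. It suffices to treat
transvections (affine curve) and diagonal matrices (exponential curve), which generate the group. -/
theorem exists_entire_path_one {n : ℕ} {S : Matrix (Fin n) (Fin n) ℂ} (hS : S.det ≠ 0) :
    ∃ R R' : ℂ → Matrix (Fin n) (Fin n) ℂ,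
      (∀ i j, Differentiable ℂ fun z => R z i j) ∧ (∀ i j, Differentiable ℂ fun z => R' z i j) ∧
      (∀ z, R z * R' z = 1) ∧ R 0 = 1 ∧ R 1 = S := by
  refine Matrix.diagonal_transvection_induction_of_det_ne_zero
    (fun S => ∃ R R' : ℂ → Matrix (Fin n) (Fin n) ℂ,
      (∀ i j, Differentiable ℂ fun z => R z i j) ∧ (∀ i j, Differentiable ℂ fun z => R' z i j) ∧
      (∀ z, R z * R' z = 1) ∧ R 0 = 1 ∧ R 1 = S) S hS ?_ ?_ ?_
  · intro D hD
    have hD0 : ∀ i, D i ≠ 0 := by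
      simpa [Matrix.det_diagonal, Finset.prod_ne_zero_iff] using hD
    refine ⟨fun z => Matrix.diagonal fun i => Complex.exp (z * Complex.log (D i)),
      fun z => Matrix.diagonal fun i => Complex.exp (-(z * Complex.log (D i))), ?_, ?_, ?_, ?_, ?_⟩
    · intro i j
      by_cases h : i = j
      · subst h; simp only [Matrix.diagonal_apply_eq]; fun_prop
      · simp [h]
    · intro i j
      by_cases h : i = j
      · subst h; simp only [Matrix.diagonal_apply_eq]; fun_prop
      · simp [h]
    · intro z
      simp [Matrix.diagonal_mul_diagonal, ← Complex.exp_add]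
    · simp
    · simp [Complex.exp_log (hD0 _)]
  · intro t
    refine ⟨fun z => Matrix.transvection t.i t.j (z * t.c),
      fun z => Matrix.transvection t.i t.j (-(z * t.c)), ?_, ?_, ?_, ?_, ?_⟩
    · intro i j
      simp only [Matrix.transvection, Matrix.add_apply, Matrix.single_apply]
      split_ifs <;> fun_prop
    · intro i j
      simp only [Matrix.transvection, Matrix.add_apply, Matrix.single_apply]
      split_ifs <;> fun_prop
    · intro z
      simp only
      rw [Matrix.transvection_mul_transvection_same _ _ t.hij]
      simp
    · simp
    · simp [Matrix.TransvectionStruct.toMatrix]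
  · intro A B hA hB ihA ihB
    obtain ⟨R, R', hR, hR', h1, h0, hA⟩ := ihA
    obtain ⟨S, S', hS, hS', g1, g0, hB⟩ := ihB
    refine ⟨fun z => R z * S z, fun z => S' z * R' z, ?_, ?_, ?_, ?_, ?_⟩
    · intro i j
      simp only [Matrix.mul_apply]
      fun_prop
    · intro i j
      simp only [Matrix.mul_apply]
      fun_prop
    · intro z
      rw [Matrix.mul_assoc, ← Matrix.mul_assoc (S z), g1, Matrix.one_mul, h1]
    · simp [h0, g0]
    · simp [hA, hB]

theorem exists_entire_path {n : ℕ} {P Q : Matrix (Fin n) (Fin n) ℂ} (hP : P.det ≠ 0)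
    (hQ : Q.det ≠ 0) {a : ℂ} (ha : a ≠ 0) :
    ∃ R R' : ℂ → Matrix (Fin n) (Fin n) ℂ,
      (∀ i j, Differentiable ℂ fun z => R z i j) ∧ (∀ i j, Differentiable ℂ fun z => R' z i j) ∧
      (∀ z, R z * R' z = 1) ∧ R 0 = P ∧ R a = Q := by
  have hPP : P⁻¹ * P = 1 := Matrix.nonsing_inv_mul _ (Ne.isUnit hP)
  have hPP' : P * P⁻¹ = 1 := Matrix.mul_nonsing_inv _ (Ne.isUnit hP)
  have hdet : (Q * P⁻¹).det ≠ 0 := by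
    rw [Matrix.det_mul, Matrix.det_nonsing_inv, Ring.inverse_eq_inv']
    exact mul_ne_zero hQ (inv_ne_zero hP)
  obtain ⟨R, R', hR, hR', h1, h0, hS⟩ := exists_entire_path_one hdet
  refine ⟨fun z => R (z / a) * P, fun z => P⁻¹ * R' (z / a), ?_, ?_, ?_, ?_, ?_⟩
  · intro i j
    have : ∀ i j, Differentiable ℂ fun z => R (z / a) i j := fun i j =>
      (hR i j).comp (differentiable_id.div_const a)
    simp only [Matrix.mul_apply]
    fun_prop
  · intro i j
    have : ∀ i j, Differentiable ℂ fun z => R' (z / a) i j := fun i j =>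
      (hR' i j).comp (differentiable_id.div_const a)
    simp only [Matrix.mul_apply]
    fun_prop
  · intro z
    rw [Matrix.mul_assoc, ← Matrix.mul_assoc P, hPP', Matrix.one_mul, h1]
  · simp [h0]
  · simp [ha, hS, Matrix.mul_assoc, hPP]

/-! ### Bidiagonal matrices and their conjugates -/

/-- The matrix with diagonal `d`, ones just below the diagonal, and zeros elsewhere. It is a cyclic
matrix with eigenvalues `d i`, used in place of the companion matrix of `∏ i, (X - d i)`. -/
def lowerBidiagonal {m : ℕ} (d : Fin (m + 1) → ℂ) : Matrix (Fin (m + 1)) (Fin (m + 1)) ℂ :=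
  Matrix.of fun i j => if i = j then d i else if (i : ℕ) = j + 1 then 1 else 0

theorem lowerBidiagonal_sub_scalar {m : ℕ} (d : Fin (m + 1) → ℂ) (μ : ℂ) :
    lowerBidiagonal d - Matrix.scalar _ μ = lowerBidiagonal fun i => d i - μ := by
  ext i j
  by_cases h : i = j <;> simp [lowerBidiagonal, h]

theorem lowerBidiagonal_eq_zero_of_lt {m : ℕ} (d : Fin (m + 1) → ℂ) {i j : Fin (m + 1)}
    (hij : i < j) : lowerBidiagonal d i j = 0 := by
  have h : (i : ℕ) < j := hij
  simp [lowerBidiagonal, hij.ne, show (i : ℕ) ≠ j + 1 by omega]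

/-- The top right cofactor is `±1`, so adding `z` in that corner of a singular bidiagonal matrix
makes the determinant `± z`: it moves at first order. -/
theorem norm_det_lowerBidiagonal_add_single {m : ℕ} {d : Fin (m + 1) → ℂ} {i : Fin (m + 1)}
    (hi : d i = 0) (z : ℂ) :
    ‖(lowerBidiagonal d + Matrix.single 0 (Fin.last m) z).det‖ = ‖z‖ := by
  have hdet : (lowerBidiagonal d).det = 0 := by
    rw [Matrix.det_of_isLowerTriangular _ fun i j hij => lowerBidiagonal_eq_zero_of_lt d hij]
    exact Finset.prod_eq_zero (Finset.mem_univ i) (by simp [lowerBidiagonal, hi])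
  have hminor : ((lowerBidiagonal d).submatrix Fin.succ (Fin.last m).succAbove).det = 1 := by
    rw [Matrix.det_of_isUpperTriangular]
    · refine Finset.prod_eq_one fun i _ => ?_
      have h : i.succ ≠ i.castSucc := by simp [Fin.ext_iff]
      simp [lowerBidiagonal, h]
    · intro i j hij
      have h : (j : ℕ) < i := hij
      have h1 : i.succ ≠ j.castSucc := by simp [Fin.ext_iff]; omega
      simp [lowerBidiagonal, h1, h.ne']
  have hexp : (lowerBidiagonal d + Matrix.single 0 (Fin.last m) z).det =
      (lowerBidiagonal d).det + (-1) ^ m * z := by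
    rw [Matrix.det_succ_row_zero, Matrix.det_succ_row_zero (lowerBidiagonal d)]
    have hsub : ∀ j : Fin (m + 1), (lowerBidiagonal d + Matrix.single 0 (Fin.last m) z).submatrix
        Fin.succ j.succAbove = (lowerBidiagonal d).submatrix Fin.succ j.succAbove := by
      intro j
      ext a b
      simp [(Fin.succ_ne_zero a).symm]
    simp only [hsub, Matrix.add_apply, mul_add, add_mul, Finset.sum_add_distrib]
    congr 1
    rw [Finset.sum_eq_single (Fin.last m)]
    · rw [hminor]; simp
    · intro j _ hj
      simp [hj.symm]
    · simp
  rw [hexp, hdet]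
  simp

open Polynomial in
/-- The Krylov matrix of `T` at the first basis vector `e₀`, in the Newton basis with nodes `d`: its
column `j` is `(T - d 0) ⋯ (T - d (j - 1)) e₀`. -/
noncomputable def newtonKrylov {m : ℕ} (d : Fin (m + 1) → ℂ)
    (T : Matrix (Fin (m + 1)) (Fin (m + 1)) ℂ) : Matrix (Fin (m + 1)) (Fin (m + 1)) ℂ :=
  Matrix.of fun i j => aeval T (∏ k ∈ Finset.Iio j, (X - C (d k))) i 0

theorem charpoly_of_lowerTriangular {m : ℕ} {T : Matrix (Fin (m + 1)) (Fin (m + 1)) ℂ}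
    (hT : ∀ i j, i < j → T i j = 0) :
    T.charpoly = ∏ k, (Polynomial.X - Polynomial.C (T k k)) := by
  rw [← Matrix.charpoly_transpose, Matrix.charpoly_of_isUpperTriangular]
  · rfl
  · exact fun i j hij => hT j i hij

open Polynomial in
/-- With the diagonal of a triangular `T` as nodes, the Newton–Krylov matrix intertwines `T` with the
bidiagonal matrix; for the last column this is the Cayley–Hamilton theorem. -/
theorem mul_newtonKrylov {m : ℕ} {d : Fin (m + 1) → ℂ}
    {T : Matrix (Fin (m + 1)) (Fin (m + 1)) ℂ} (hT : ∀ i j, i < j → T i j = 0)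
    (hd : ∀ i, T i i = d i) :
    T * newtonKrylov d T = newtonKrylov d T * lowerBidiagonal d := by
  have hIic : ∀ j : Fin (m + 1), ∏ k ∈ Finset.Iic j, (X - C (d k)) =
      (X - C (d j)) * ∏ k ∈ Finset.Iio j, (X - C (d k)) := by
    intro j
    rw [← Finset.Iio_insert, Finset.prod_insert (by simp)]
  have hmul : ∀ i j, (T * newtonKrylov d T) i j =
      newtonKrylov d T i j * d j + aeval T (∏ k ∈ Finset.Iic j, (X - C (d k))) i 0 := by
    intro i j
    rw [hIic, map_mul, map_sub, aeval_X, aeval_C, sub_mul, Matrix.sub_apply,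
      Algebra.algebraMap_eq_smul_one, smul_mul_assoc, one_mul, Matrix.smul_apply]
    simp only [Matrix.mul_apply, newtonKrylov, Matrix.of_apply, smul_eq_mul]
    ring
  ext i j
  rw [hmul, Matrix.mul_apply]
  induction j using Fin.lastCases with
  | last =>
    have h0 : aeval T (∏ k ∈ Finset.Iic (Fin.last m), (X - C (d k))) = 0 := by
      have : Finset.Iic (Fin.last m) = Finset.univ := by ext; simp [Fin.le_last]
      rw [this]
      simp only [← hd]
      rw [← charpoly_of_lowerTriangular hT]
      exact Matrix.aeval_self_charpoly T
    rw [h0, Finset.sum_eq_single (Fin.last m)]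
    · simp [lowerBidiagonal]
    · intro k _ hk
      have := k.isLt
      simp [lowerBidiagonal, hk, show (k : ℕ) ≠ m + 1 by omega]
    · simp
  | cast j =>
    have hI : Finset.Iic j.castSucc = Finset.Iio j.succ := by
      ext k
      simp [Fin.le_def, Fin.lt_def]
    have hne : j.castSucc ≠ j.succ := by simp [Fin.ext_iff]
    rw [hI, Finset.sum_eq_add_of_mem j.castSucc j.succ (by simp) (by simp) hne]
    · simp [lowerBidiagonal, hne.symm, newtonKrylov]
    · rintro k - ⟨h1, h2⟩
      have h3 : (k : ℕ) ≠ j + 1 := fun h => h2 (Fin.ext (by simpa using h))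
      simp [lowerBidiagonal, h1, h3]

open Polynomial in
theorem newtonKrylov_lowerBidiagonal {m : ℕ} (d : Fin (m + 1) → ℂ) :
    newtonKrylov d (lowerBidiagonal d) = 1 := by
  suffices h : ∀ j : Fin (m + 1), ∀ i,
      aeval (lowerBidiagonal d) (∏ k ∈ Finset.Iio j, (X - C (d k))) i 0 =
        (1 : Matrix (Fin (m + 1)) (Fin (m + 1)) ℂ) i j by
    ext i j
    exact h j i
  intro j
  induction j using Fin.induction with
  | zero =>
    intro i
    have : Finset.Iio (0 : Fin (m + 1)) = ∅ := by ext; simp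
    simp [this]
  | succ j ih =>
    intro i
    have hI : Finset.Iio j.succ = insert j.castSucc (Finset.Iio j.castSucc) := by
      ext k
      simp [Fin.le_def, Fin.lt_def, Nat.le_iff_lt_or_eq, or_comm]
    rw [hI, Finset.prod_insert (by simp), map_mul, Matrix.mul_apply]
    simp only [ih, Matrix.one_apply]
    have hne : j.castSucc ≠ j.succ := by simp [Fin.ext_iff]
    by_cases h1 : i = j.castSucc
    · subst h1
      simp [lowerBidiagonal, hne, Matrix.algebraMap_matrix_apply]
    · by_cases h2 : i = j.succ
      · subst h2
        simp [lowerBidiagonal, h1, Matrix.algebraMap_matrix_apply]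
      · have h3 : (i : ℕ) ≠ j + 1 := fun h => h2 (Fin.ext (by simpa using h))
        simp [lowerBidiagonal, h1, h2, h3, Matrix.algebraMap_matrix_apply]

theorem differentiable_aeval_apply {n : ℕ} {M : ℂ → Matrix (Fin n) (Fin n) ℂ}
    (hM : ∀ i j, Differentiable ℂ fun z => M z i j) (p : Polynomial ℂ) (i j : Fin n) :
    Differentiable ℂ fun z => Polynomial.aeval (M z) p i j := by
  have hpow : ∀ k : ℕ, ∀ i j, Differentiable ℂ fun z => (M z ^ k) i j := by
    intro k
    induction k with
    | zero => simp
    | succ k ih =>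
      intro i j
      simp only [pow_succ, Matrix.mul_apply]
      exact Differentiable.fun_sum fun k _ => (ih i k).mul (hM k j)
  simp only [Polynomial.aeval_eq_sum_range, Matrix.sum_apply, Matrix.smul_apply]
  exact Differentiable.fun_sum fun k _ => (hpow k i j).const_smul (p.coeff k)

/-- Every matrix is a limit of matrices similar to one fixed cyclic matrix. On the complex line
joining the triangular form `T` to the bidiagonal matrix with the same diagonal, the determinant of
the Newton–Krylov matrix is an entire function with value `1` at `1`; hence it is nonzero near, but
off, the parameter `0` of `T`. -/
theorem mem_closure_conj_lowerBidiagonal {m : ℕ} (A : Matrix (Fin (m + 1)) (Fin (m + 1)) ℂ)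
    {P Q T : Matrix (Fin (m + 1)) (Fin (m + 1)) ℂ} (hPQ : P * Q = 1) (hA : A = P * T * Q)
    (hT : ∀ i j, i < j → T i j = 0) :
    A ∈ closure {M | ∃ S : Matrix (Fin (m + 1)) (Fin (m + 1)) ℂ,
      S.det ≠ 0 ∧ M = S * lowerBidiagonal (fun i => T i i) * S⁻¹} := by
  set d : Fin (m + 1) → ℂ := fun i => T i i with hd
  set N : ℂ → Matrix (Fin (m + 1)) (Fin (m + 1)) ℂ :=
    fun z => T + z • (lowerBidiagonal d - T) with hN
  have hNd : ∀ i j, Differentiable ℂ fun z => N z i j := by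
    intro i j
    simp only [hN, Matrix.add_apply, Matrix.smul_apply, smul_eq_mul]
    fun_prop
  have hNlow : ∀ z i j, i < j → N z i j = 0 := fun z i j hij => by
    simp [hN, hT i j hij, lowerBidiagonal_eq_zero_of_lt d hij]
  have hNdiag : ∀ z i, N z i i = d i := fun z i => by
    simp [hN, lowerBidiagonal, hd]
  have hK : Differentiable ℂ fun z => (newtonKrylov d (N z)).det := by
    have : ∀ i j, Differentiable ℂ fun z => newtonKrylov d (N z) i j := fun i j =>
      differentiable_aeval_apply hNd _ i 0
    simp only [Matrix.det_apply']
    fun_prop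
  have hK1 : (newtonKrylov d (N 1)).det = 1 := by
    simp [hN, newtonKrylov_lowerBidiagonal]
  have hne : ∀ᶠ z in 𝓝[≠] (0 : ℂ), (newtonKrylov d (N z)).det ≠ 0 := by
    have han : AnalyticOnNhd ℂ (fun z => (newtonKrylov d (N z)).det) Set.univ :=
      fun z _ => hK.analyticAt z
    refine (han 0 trivial).eventually_eq_zero_or_eventually_ne_zero.resolve_left fun h => ?_
    have := han.eqOn_zero_of_preconnected_of_eventuallyEq_zero isPreconnected_univ trivial h
      (Set.mem_univ 1)
    simp [hK1] at this
  have hPdet : P.det ≠ 0 := by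
    intro h
    have := congrArg Matrix.det hPQ
    simp [h] at this
  have htend : Filter.Tendsto (fun z => P * N z * Q) (𝓝[≠] 0) (𝓝 A) := by
    have : Continuous fun z => P * N z * Q := by
      simp only [hN]
      fun_prop
    have h0 := this.tendsto 0
    simp only [hN, zero_smul, add_zero, ← hA] at h0
    exact h0.mono_left nhdsWithin_le_nhds
  refine mem_closure_of_tendsto htend (hne.mono fun z hz => ?_)
  refine ⟨P * newtonKrylov d (N z), by simp [hPdet, hz], ?_⟩
  have hu : newtonKrylov d (N z) * (newtonKrylov d (N z))⁻¹ = 1 :=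
    Matrix.mul_nonsing_inv _ (Ne.isUnit hz)
  rw [Matrix.mul_inv_rev, Matrix.inv_eq_right_inv hPQ, Matrix.mul_assoc P (newtonKrylov _ _),
    ← mul_newtonKrylov (hNlow z) (hNdiag z)]
  simp only [Matrix.mul_assoc]
  rw [← Matrix.mul_assoc (newtonKrylov d (N z)) _ Q, hu, Matrix.one_mul]

/-! ### Discontinuity of the Lempert function -/

theorem lempertFunction_le {n : ℕ} {D : Set (Matrix (Fin n) (Fin n) ℂ)}
    {α : ℂ} (hα : α ∈ Metric.ball (0 : ℂ) 1) {φ : ℂ → Matrix (Fin n) (Fin n) ℂ}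
    (hφ : ∀ i j, DifferentiableOn ℂ (fun ζ => φ ζ i j) (Metric.ball (0 : ℂ) 1))
    (hmaps : Set.MapsTo φ (Metric.ball (0 : ℂ) 1) D) :
    lempertFunction D (φ 0) (φ α) ≤ ‖α‖ :=
  csInf_le ⟨0, by rintro _ ⟨β, -, -, -, -, -, -, rfl⟩; exact norm_nonneg β⟩
    ⟨α, hα, φ, hφ, hmaps, rfl, rfl, rfl⟩

/-- The upper estimate: the disc `z ↦ C + z • E` can be conjugated by an entire curve of invertible
matrices with prescribed values at `0` and `α`, so the bound does not depend on `P` and `Q`. -/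
theorem lempertFunction_conj_le {n : ℕ} {C E P Q : Matrix (Fin n) (Fin n) ℂ}
    (hP : P.det ≠ 0) (hQ : Q.det ≠ 0)
    (hC : ∀ z ∈ Metric.ball (0 : ℂ) 1, C + z • E ∈ spectralBall n)
    {α : ℂ} (hα : α ∈ Metric.ball (0 : ℂ) 1) (hα0 : α ≠ 0) :
    lempertFunction (spectralBall n) (P * C * P⁻¹) (Q * (C + α • E) * Q⁻¹) ≤ ‖α‖ := by
  obtain ⟨R, R', hR, hR', h1, h0, ha⟩ := exists_entire_path hP hQ hα0
  have hφ0 : R 0 * (C + (0 : ℂ) • E) * R' 0 = P * C * P⁻¹ := by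
    rw [← Matrix.inv_eq_right_inv (h1 0), h0, zero_smul, add_zero]
  have hφα : R α * (C + α • E) * R' α = Q * (C + α • E) * Q⁻¹ := by
    rw [← Matrix.inv_eq_right_inv (h1 α), ha]
  rw [← hφ0, ← hφα]
  refine lempertFunction_le (φ := fun z => R z * (C + z • E) * R' z) hα (fun i j => ?_)
    fun z hz => conj_mem_spectralBall (h1 z) (hC z hz)
  refine Differentiable.differentiableOn ?_
  simp only [Matrix.mul_apply, Matrix.add_apply, Matrix.smul_apply, smul_eq_mul]
  fun_prop

theorem eventually_affine_disc_mem {n : ℕ} {A : Matrix (Fin n) (Fin n) ℂ}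
    (hA : A ∈ spectralBall n) :
    ∀ᶠ B in 𝓝 A, ∀ z ∈ Metric.closedBall (0 : ℂ) 2, A + z • (B - A) ∈ spectralBall n := by
  refine (isCompact_closedBall (0 : ℂ) 2).eventually_forall_of_forall_eventually fun z _ => ?_
  have hc : Continuous fun p : Matrix (Fin n) (Fin n) ℂ × ℂ => A + p.2 • (p.1 - A) := by
    fun_prop
  exact hc.continuousAt.eventually_mem
    ((isOpen_spectralBall n).mem_nhds (by simpa using hA))

/-- The hypothesis `hAB` provides a disc through `A` and `B`, which excludes the value `0` that `sInf`
takes on the empty set. -/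
theorem le_lempertFunction {n : ℕ} {A B : Matrix (Fin n) (Fin n) ℂ} {μ : ℂ}
    (hμ : ‖μ‖ ≤ 1) (hrank : (A - Matrix.scalar (Fin n) μ).rank + 2 ≤ n)
    (hAB : ∀ z ∈ Metric.closedBall (0 : ℂ) 2, A + z • (B - A) ∈ spectralBall n)
    {r : ℝ} (hr : 2 ^ n * r ^ 2 ≤ ‖(B - Matrix.scalar (Fin n) μ).det‖) :
    r ≤ lempertFunction (spectralBall n) A B := by
  refine le_csInf ?_ ?_
  · refine ⟨_, 1 / 2, by simp; norm_num, fun z => A + (2 * z) • (B - A), fun i j => ?_,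
      fun z hz => hAB _ ?_, by simp, by simp, rfl⟩
    · simp only [Matrix.add_apply, Matrix.smul_apply, smul_eq_mul]
      fun_prop
    · rw [mem_ball_zero_iff] at hz
      rw [mem_closedBall_zero_iff, norm_mul, Complex.norm_ofNat]
      linarith
  · rintro _ ⟨α, hα, φ, hφ, hmaps, h0, hB, rfl⟩
    have h := hr.trans (norm_det_sub_scalar_le_of_disc hμ hrank hα hφ hmaps h0 hB)
    exact le_of_sq_le_sq (le_of_mul_le_mul_left h (by positivity)) (norm_nonneg α)

/-- At a derogatory `A` the function `l(·, B)` is discontinuous for `B` arbitrarily close to `A`. -/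
theorem frequently_not_continuousWithinAt {n : ℕ} {A : Matrix (Fin n) (Fin n) ℂ}
    (hA : A ∈ spectralBall n) (hcyc : ¬ IsCyclicMatrix A) :
    ∃ᶠ B in 𝓝[spectralBall n] A, ¬ ContinuousWithinAt
      (fun M => lempertFunction (spectralBall n) M B) (spectralBall n) A := by
  obtain ⟨μ, hμA, hrank⟩ := exists_rank_add_two_le hcyc
  have hμ := norm_lt_one_of_mem_spectrum hA hμA
  obtain ⟨m, rfl⟩ : ∃ m, n = m + 1 := ⟨n - 1, by omega⟩
  obtain ⟨P, Q, T, hPQ, hAT, hT⟩ := exists_lowerTriangular_conj A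
  set C := lowerBidiagonal fun i => T i i with hC
  have hcl := mem_closure_conj_lowerBidiagonal A hPQ hAT hT
  rw [← hC] at hcl
  have hspec : spectrum ℂ C = spectrum ℂ A := by
    have h1 : spectrum ℂ A = spectrum ℂ T := by
      rw [hAT]
      exact spectrum.units_conjugate (R := ℂ) (u := ⟨P, Q, hPQ, mul_eq_one_comm.mp hPQ⟩)
    rw [h1]
    ext x
    rw [Matrix.mem_spectrum_iff_isRoot_charpoly, Matrix.mem_spectrum_iff_isRoot_charpoly,
      charpoly_of_lowerTriangular hT,
      charpoly_of_lowerTriangular fun i j hij => lowerBidiagonal_eq_zero_of_lt _ hij]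
    simp [lowerBidiagonal]
  have hCmem : C ∈ spectralBall (m + 1) := by
    simpa only [spectralBall, spectralRadius, Set.mem_ofPred_eq, hspec] using hA
  obtain ⟨i, hi⟩ : ∃ i, T i i - μ = 0 := by
    have : (C.charpoly).IsRoot μ := by
      rw [← Matrix.mem_spectrum_iff_isRoot_charpoly, hspec]
      exact hμA
    rw [charpoly_of_lowerTriangular fun i j hij => lowerBidiagonal_eq_zero_of_lt _ hij,
      Polynomial.IsRoot, Polynomial.eval_prod, Finset.prod_eq_zero_iff] at this
    obtain ⟨i, -, hi⟩ := this
    refine ⟨i, ?_⟩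
    rw [← neg_eq_zero]
    simpa [hC, lowerBidiagonal] using hi
  set E₀ : Matrix (Fin (m + 1)) (Fin (m + 1)) ℂ := Matrix.single 0 (Fin.last m) 1 with hE₀
  obtain ⟨r, hr, hrC⟩ : ∃ r > 0,
      ∀ z ∈ Metric.ball (0 : ℂ) r, C + z • E₀ ∈ spectralBall (m + 1) := by
    have hc : Continuous fun z : ℂ => C + z • E₀ := by fun_prop
    have := hc.continuousAt.eventually_mem (x := 0)
      ((isOpen_spectralBall (m + 1)).mem_nhds (by simpa using hCmem))
    exact Metric.eventually_nhds_iff_ball.1 this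
  set E := (r : ℂ) • E₀ with hE
  have hdisc : ∀ z ∈ Metric.ball (0 : ℂ) 1, C + z • E ∈ spectralBall (m + 1) := by
    intro z hz
    rw [hE, smul_smul]
    refine hrC _ ?_
    rw [mem_ball_zero_iff] at hz ⊢
    simpa [abs_of_pos hr] using mul_lt_mul_of_pos_right hz hr
  have hdet : ∀ (S : Matrix (Fin (m + 1)) (Fin (m + 1)) ℂ), S.det ≠ 0 → ∀ z : ℂ,
      ‖(S * (C + z • E) * S⁻¹ - Matrix.scalar (Fin (m + 1)) μ).det‖ = ‖z‖ * r := by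
    intro S hS z
    have hSS : S * S⁻¹ = 1 := Matrix.mul_nonsing_inv _ (Ne.isUnit hS)
    have h1 : S * (C + z • E) * S⁻¹ - Matrix.scalar (Fin (m + 1)) μ =
        S * (C + z • E - Matrix.scalar (Fin (m + 1)) μ) * S⁻¹ := by
      rw [Matrix.mul_sub, Matrix.sub_mul, ← (Matrix.scalar_commute μ (Commute.all μ) S).eq,
        Matrix.mul_assoc (Matrix.scalar _ μ), hSS, Matrix.mul_one]
    have h2 : C + z • E - Matrix.scalar (Fin (m + 1)) μ =
        lowerBidiagonal (fun i => T i i - μ) + Matrix.single 0 (Fin.last m) (z * r) := by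
      rw [add_sub_right_comm, lowerBidiagonal_sub_scalar, hE, hE₀, smul_smul, Matrix.smul_single]
      simp
    have h3 : S.det * S⁻¹.det = 1 := by rw [← Matrix.det_mul, hSS, Matrix.det_one]
    rw [h1, Matrix.det_mul, Matrix.det_mul, mul_right_comm, h3, one_mul, h2,
      norm_det_lowerBidiagonal_add_single hi]
    simp [abs_of_pos hr]
  rw [(isOpen_spectralBall _).nhdsWithin_eq hA]
  intro hcont
  simp only [not_not] at hcont
  -- `B = S (C + ε E) S⁻¹` with `S` fixed first, so that `B` is close to `A` for small `ε`; the
  -- bound on `ε` makes `2 ^ n * (2 * ε) ^ 2 ≤ ε * r = ‖det (B - μ)‖`.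
  have hfreq := mem_closure_iff_frequently.1 hcl
  obtain ⟨_, ⟨S, hS, rfl⟩, hgood⟩ := (hfreq.and_eventually
    (hcont.and (eventually_affine_disc_mem hA)).eventually_nhds).exists
  have hpath : Filter.Tendsto (fun ε : ℝ => S * (C + (ε : ℂ) • E) * S⁻¹) (𝓝[>] 0)
      (𝓝 (S * C * S⁻¹)) := by
    have hc : Continuous fun ε : ℝ => S * (C + (ε : ℂ) • E) * S⁻¹ := by fun_prop
    simpa using (hc.tendsto 0).mono_left nhdsWithin_le_nhds
  have hsmall : ∀ᶠ ε : ℝ in 𝓝[>] 0, ε < min 1 (r / (2 ^ (m + 1) * 4)) :=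
    nhdsWithin_le_nhds (Iio_mem_nhds (by positivity))
  obtain ⟨ε, ⟨⟨hcontB, haff⟩, hε⟩, hε0⟩ :=
    (((hpath.eventually hgood).and hsmall).and self_mem_nhdsWithin).exists
  rw [lt_min_iff, lt_div_iff₀ (by positivity)] at hε
  have hlower := le_lempertFunction (r := 2 * ε) hμ.le hrank haff (by
    rw [hdet S hS, Complex.norm_real, Real.norm_of_nonneg hε0.le]
    nlinarith)
  rw [ContinuousWithinAt, (isOpen_spectralBall _).nhdsWithin_eq hA] at hcontB
  have hev := hcontB.eventually_const_lt (u := ε) (by linarith)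
  -- Continuity would give `ε < l(·, B)` at conjugates of `C` close to `A`.
  obtain ⟨_, ⟨S', hS', rfl⟩, hlt⟩ := (hfreq.and_eventually hev).exists
  have hupper := lempertFunction_conj_le hS' hS hdisc (α := (ε : ℂ))
    (by simpa [abs_of_pos hε0] using hε.1) (by exact_mod_cast hε0.ne')
  rw [Complex.norm_real, Real.norm_of_nonneg hε0.le] at hupper
  exact absurd hlt (not_lt.2 hupper)

theorem theorem1p3 (n : ℕ) (A : Matrix (Fin n) (Fin n) ℂ) (hA : A ∈ spectralBall n) :
    (¬ IsCyclicMatrix A →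
      ∃ B ∈ spectralBall n,
        ¬ ContinuousWithinAt (fun M => lempertFunction (spectralBall n) M B)
          (spectralBall n) A) ∧
    ((∀ᶠ B in 𝓝[spectralBall n] A,
        ContinuousWithinAt (fun M => lempertFunction (spectralBall n) M B)
          (spectralBall n) A) →
      IsCyclicMatrix A) := by
  refine ⟨fun hcyc => ?_, fun hcont => ?_⟩
  · obtain ⟨B, hB, hBmem⟩ :=
      ((frequently_not_continuousWithinAt hA hcyc).and_eventually self_mem_nhdsWithin).exists
    exact ⟨B, hBmem, hB⟩
  · by_contra hcyc
    exact frequently_not_continuousWithinAt hA hcyc (hcont.mono fun _ h => not_not.2 h)
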